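/- All structures are finite (with nonempty universe) over finite relational vocabularies. A generalized (Lindström) quantifier $Q_{\mathcal K}$ is given by an isomorphism-closed class $\mathcal K$ of $\tau$-structures; its arity is the maximum arity of a relation symbol in $\tau$, and $\mathcal Q_r$ is the collection of all quantifiers of arity at most $r$. For a set $A$ let $m_A\colon A^3\to A$ be the partial Maltsev function: $m_A(a,a,b)=m_A(b,a,a)=b$, and $m_A(a,b,c)$ is undefined if $a\neq b$ and $b\neq c$. For a relation $R\subseteq A^n$ let $m_A(R)$ be the set of all tuples obtained by applying $m_A$ coordinatewise to three tuples of $R$ such that $m_A$ is defined in every coordinate, and for a $\tau$-structure $\mathbf B$ let $m_B(\mathbf B)$ be the structure on $B$ with the relations $m_B(R^{\mathbf B})$, $R \in \tau$. The quantifier $Q_{\mathcal K}$ is Maltsev-closed if for every $\mathbf B\in\mathcal K$, every structure $\mathbf A$ on the same universe with $R^{\mathbf A}\subseteq R^{\mathbf B}\cup m_B(R^{\mathbf B})$ for all $R\in\tau$ is in $\mathcal K$. Let $\mathcal Q^{\mathcal M}_r$ be the collection of all Maltsev-closed quantifiers in $\mathcal Q_r$. For a collection $\mathcal Q$ of quantifiers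 let $\mathcal L(\mathcal Q)=\bigcup_{k}\mathcal L^k(\mathcal Q)$, where $\mathcal L^k(\mathcal Q)$ is the extension of the infinitary logic with $k$ variables by all quantifiers in $\mathcal Q$. Write $\mathcal L(\mathcal Q)\le\mathcal L(\mathcal Q')$ if every sentence of $\mathcal L(\mathcal Q)$ is equivalent, over finite structures, to a sentence of $\mathcal L(\mathcal Q')$, and $\mathcal L(\mathcal Q)\lneq\mathcal L(\mathcal Q')$ if moreover $\mathcal L(\mathcal Q')\not\le\mathcal L(\mathcal Q)$. **Theorem.** For every $r\ge 3$, $$\mathcal L(\mathcal Q^{\mathcal M}_r)\lneq \mathcal L(\mathcal Q^{\mathcal M}_{r+1}).$$ Moreover, let $\mathbf B_{r+1}=(\{0,1\},R_0,R_1)$ with $R_i=\{(a_1,\dots,a_{r+1})\mid \sum_{j} a_j\equiv i \pmod 2\}$, and let $\mathrm{CSP}(\mathbf B_{r+1})$ be the class of all finite structures that admit a homomorphism to $\mathbf B_{r+1}$. Then $\mathbf B_{r+1}$ has a Maltsev polymorphism (a total polymorphism $m$ with $m(a,a,b)=m(b,a,a)=b$ for all $a,b$), the quantifier $Q_{\mathrm{CSP}(\mathbf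 B_{r+1})}$ is in $\mathcal Q^{\mathcal M}_{r+1}$, and $\mathrm{CSP}(\mathbf B_{r+1})$ is definable in $\mathcal L(\mathcal Q^{\mathcal M}_{r+1})$ but not in $\mathcal L(\mathcal Q_r)$. -/

import Mathlib

namespace GenQuant

open FirstOrder

/-! ### Finite relational structures -/

/-- A finite structure (with nonempty universe) over the vocabulary `τ`. -/
structure FinStructure (τ : FirstOrder.Language.{0, 0}) where
  Carrier : Type
  [str : τ.Structure Carrier]
  [fin : Finite Carrier]
  [nonem : Nonempty Carrier]

attribute [instance] FinStructure.str FinStructure.fin FinStructure.nonem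

/-- The vocabularies under consideration: finite sets of relation symbols. -/
class FinRelational (τ : FirstOrder.Language.{0, 0}) : Prop where
  relational : τ.IsRelational
  finite : Finite (Σ n, τ.Relations n)

attribute [instance] FinRelational.relational FinRelational.finite

/-- The structure on `A` in which every symbol `R` is interpreted by the relation `rel n R`. -/
@[reducible] def ofRelations {τ : FirstOrder.Language.{0, 0}} [FinRelational τ] {A : Type}
    (rel : ∀ n, τ.Relations n → Set (Fin n → A)) : τ.Structure A where
  funMap := fun f => isEmptyElim f
  RelMap := fun {n} R a => a ∈ rel n R

/-- The interpretation of the symbol `R` in the structure `S` on `A`, as a set of tuples. -/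
def relOf {τ : FirstOrder.Language.{0, 0}} {A : Type} (S : τ.Structure A) {n : ℕ} (R : τ.Relations n) :
    Set (Fin n → A) :=
  {a | S.RelMap R a}

/-- `S ≤ T` for two structures on the same universe: every relation of `S` is contained in the
corresponding relation of `T`. -/
def StrLE {τ : FirstOrder.Language.{0, 0}} {A : Type} (S T : τ.Structure A) : Prop :=
  ∀ (n : ℕ) (R : τ.Relations n), relOf S R ⊆ relOf T R

/-- The union of two structures on the same universe. -/
@[reducible] def strUnion {τ : FirstOrder.Language.{0, 0}} [FinRelational τ] {A : Type} (S T : τ.Structure A) :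
    τ.Structure A :=
  ofRelations fun _ R => relOf S R ∪ relOf T R

/-! ### Generalized (Lindström) quantifiers -/

/-- A generalized quantifier: a finite relational vocabulary together with an
isomorphism-closed class of finite structures of that vocabulary. -/
structure Quantifier where
  voc : FirstOrder.Language.{0, 0}
  [finRel : FinRelational voc]
  cls : Set (FinStructure voc)
  iso_closed : ∀ A B : FinStructure voc,
    A ∈ cls → Nonempty (A.Carrier ≃[voc] B.Carrier) → B ∈ cls

attribute [instance] Quantifier.finRel

/-- The structure with universe `A` and relations `rel n R` belongs to the class of `q`. -/
def Quantifier.Holds (q : Quantifier) (A : Type) [Finite A] [Nonempty A]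
    (rel : ∀ n, q.voc.Relations n → Set (Fin n → A)) : Prop :=
  FinStructure.mk (str := ofRelations rel) A ∈ q.cls

/-- `𝒬_r`: the collection of all quantifiers of arity at most `r`. -/
def quantifiersOfArity (r : ℕ) : Set Quantifier :=
  {q | ∀ n, Nonempty (q.voc.Relations n) → n ≤ r}

/-! ### The logics `𝓛(𝒬)` -/

/-- Formulas of `𝓛^k(𝒬)` of vocabulary `σ`: infinitary logic with the `k` variables indexed by
`Fin k`, extended by the quantifiers in `𝒬`. In `quant q hq y ψ`, the tuple of distinct variables
`y n R` is bound in the formula `ψ n R`, for each relation symbol `R` of the vocabulary of `q`.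
The remaining connectives (disjunctions, universal quantifier) are expressed by negation. -/
inductive Formula (𝒬 : Set Quantifier) (σ : FirstOrder.Language.{0, 0}) (k : ℕ) : Type 1
  | equal (i j : Fin k) : Formula 𝒬 σ k
  | rel (n : ℕ) (R : σ.Relations n) (v : Fin n → Fin k) : Formula 𝒬 σ k
  | neg (φ : Formula 𝒬 σ k) : Formula 𝒬 σ k
  | conj (ι : Type) (φ : ι → Formula 𝒬 σ k) : Formula 𝒬 σ k
  | ex (i : Fin k) (φ : Formula 𝒬 σ k) : Formula 𝒬 σ k
  | quant (q : Quantifier) (hq : q ∈ 𝒬)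
      (y : ∀ n, q.voc.Relations n → (Fin n ↪ Fin k))
      (ψ : ∀ n, q.voc.Relations n → Formula 𝒬 σ k) : Formula 𝒬 σ k

/-- The set of free variables of a formula. -/
def Formula.free {𝒬 : Set Quantifier} {σ : FirstOrder.Language.{0, 0}} {k : ℕ} :
    Formula 𝒬 σ k → Set (Fin k)
  | .equal i j => {i, j}
  | .rel _ _ v => Set.range v
  | .neg φ => φ.free
  | .conj _ φ => {x | ∃ i, x ∈ (φ i).free}
  | .ex i φ => φ.free \ {i}
  | .quant _ _ y ψ => {x | ∃ n R, x ∈ (ψ n R).free ∧ x ∉ Set.range (y n R)}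

/-- `φ.Sat A α` means `(A, α) ⊨ φ`. Here `Function.extend (y n R) b α` is the assignment
`α[b / y n R]`. -/
def Formula.Sat {𝒬 : Set Quantifier} {σ : FirstOrder.Language.{0, 0}} {k : ℕ} (A : FinStructure σ) :
    Formula 𝒬 σ k → (Fin k → A.Carrier) → Prop
  | .equal i j, α => α i = α j
  | .rel _ R v, α => A.str.RelMap R (fun s => α (v s))
  | .neg φ, α => ¬ φ.Sat A α
  | .conj _ φ, α => ∀ i, (φ i).Sat A α
  | .ex i φ, α => ∃ a : A.Carrier, φ.Sat A (Function.update α i a)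
  | .quant q _ y ψ, α =>
      q.Holds A.Carrier fun n R => {b | (ψ n R).Sat A (Function.extend (y n R) b α)}

/-- A class of finite `σ`-structures is definable in `𝓛(𝒬) = ⋃ₖ 𝓛^k(𝒬)` if it is the class of
models of a sentence (a formula without free variables). -/
def Definable (𝒬 : Set Quantifier) {σ : FirstOrder.Language.{0, 0}} (C : Set (FinStructure σ)) : Prop :=
  ∃ (k : ℕ) (φ : Formula 𝒬 σ k), φ.free = ∅ ∧
    ∀ A : FinStructure σ, A ∈ C ↔ ∀ α : Fin k → A.Carrier, φ.Sat A α

/-- `𝓛(𝒬) ≤ 𝓛(𝒬')`: every sentence of `𝓛(𝒬)`, over any finite relational vocabulary, is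
equivalent over finite structures to a sentence of `𝓛(𝒬')`. -/
def LogicLE (𝒬 𝒬' : Set Quantifier) : Prop :=
  ∀ (σ : FirstOrder.Language.{0, 0}) [FinRelational σ] (C : Set (FinStructure σ)),
    Definable 𝒬 C → Definable 𝒬' C

/-- `𝓛(𝒬)` is strictly weaker than `𝓛(𝒬')`. -/
def LogicLT (𝒬 𝒬' : Set Quantifier) : Prop :=
  LogicLE 𝒬 𝒬' ∧ ¬ LogicLE 𝒬' 𝒬

/-! ### Closure under partial polymorphisms -/

/-- A family of `l`-ary partial functions, one on every set. -/
abbrev PartialFamily (l : ℕ) := ∀ A : Type, (Fin l → A) →. A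

/-- `p(R)`: all tuples obtained by applying `p` column-wise to `l` tuples of `R` (the rows
`M 0, …, M (l - 1)` of a matrix) such that `p` is defined on every column. -/
def relImage {l : ℕ} {A : Type} (p : (Fin l → A) →. A) {n : ℕ} (R : Set (Fin n → A)) :
    Set (Fin n → A) :=
  {b | ∃ M : Fin l → Fin n → A, (∀ i, M i ∈ R) ∧ ∀ j, b j ∈ p (fun i => M i j)}

/-- `p(S)`: the structure whose relations are the `p(R)` for the relations `R` of `S`. -/
@[reducible] def strImage {τ : FirstOrder.Language.{0, 0}} [FinRelational τ] {l : ℕ} {A : Type} (p : (Fin l → A) →. A)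
    (S : τ.Structure A) : τ.Structure A :=
  ofRelations fun _ R => relImage p (relOf S R)

/-- A quantifier with class `𝒦` is `P`-closed if `𝐁 ∈ 𝒦` and `𝐀 ≤ 𝐁 ∪ p_B(𝐁)` imply
`𝐀 ∈ 𝒦`. -/
def PClosed {l : ℕ} (P : PartialFamily l) (q : Quantifier) : Prop :=
  ∀ (B : Type) [Finite B] [Nonempty B] (SA SB : q.voc.Structure B),
    FinStructure.mk (str := SB) B ∈ q.cls →
    StrLE SA (strUnion SB (strImage (P B) SB)) →
    FinStructure.mk (str := SA) B ∈ q.cls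

open Classical in
/-- The partial Maltsev family: `m(a, a, b) = m(b, a, a) = b`, and `m(a, b, c)` is undefined if
`a ≠ b` and `b ≠ c`. -/
noncomputable def maltsev : PartialFamily 3 := fun _ x =>
  ⟨x 0 = x 1 ∨ x 1 = x 2, fun _ => if x 0 = x 1 then x 2 else x 0⟩

theorem mem_maltsev {A : Type} (a b c d : A) :
    d ∈ maltsev A ![a, b, c] ↔ (a = b ∧ d = c) ∨ (b = c ∧ d = a) := by
  classical
  simp only [maltsev, Part.mem_mk_iff]
  by_cases h : a = b
  · subst h
    simp only [Matrix.cons_val]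
    grind
  · simp only [Matrix.cons_val]
    grind

/-- `𝒬^𝓜_r`: the quantifiers of arity at most `r` closed under the partial Maltsev family. -/
def maltsevQuantifiers (r : ℕ) : Set Quantifier :=
  {q | q ∈ quantifiersOfArity r ∧ PClosed maltsev q}

/-! ### Constraint satisfaction problems and the parity template -/

/-- `CSP(𝐁)`: the class of all finite structures with a homomorphism to `𝐁`. -/
def CSP {τ : FirstOrder.Language.{0, 0}} (B : FinStructure τ) : Set (FinStructure τ) :=
  {A | Nonempty (A.Carrier →[τ] B.Carrier)}

/-- The CSP quantifier with template `𝐁`. -/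
abbrev cspQuantifier {τ : FirstOrder.Language.{0, 0}} [FinRelational τ] (B : FinStructure τ) : Quantifier where
  voc := τ
  cls := CSP B
  iso_closed := fun _ _ ⟨h⟩ ⟨e⟩ => ⟨h.comp e.symm.toHom⟩

/-- `𝐁` has a (total) polymorphism `m` satisfying the Maltsev identities
`m(a, a, b) = m(b, a, a) = b`. -/
def HasMaltsevPolymorphism {τ : FirstOrder.Language.{0, 0}} (B : FinStructure τ) : Prop :=
  ∃ m : B.Carrier → B.Carrier → B.Carrier → B.Carrier,
    (∀ a b, m a a b = b ∧ m b a a = b) ∧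
    ∀ (n : ℕ) (R : τ.Relations n), ∀ x ∈ relOf B.str R, ∀ y ∈ relOf B.str R, ∀ z ∈ relOf B.str R,
      (fun j => m (x j) (y j) (z j)) ∈ relOf B.str R

/-- Two relation symbols `R₀, R₁`, both of arity `r`. -/
inductive ParityRel (r : ℕ) : ℕ → Type
  | R (i : ZMod 2) : ParityRel r r

/-- The vocabulary `{R₀, R₁}` of the parity template. -/
abbrev parityVoc (r : ℕ) : FirstOrder.Language.{0, 0} := ⟨fun _ => Empty, ParityRel r⟩

instance parityVoc_finRelational (r : ℕ) : FinRelational (parityVoc r) where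
  relational := fun _ => inferInstanceAs (IsEmpty Empty)
  finite := Finite.of_surjective
    (fun i : ZMod 2 => (⟨r, ParityRel.R i⟩ : Σ n, (parityVoc r).Relations n))
    (by rintro ⟨_, ⟨i⟩⟩; exact ⟨i, rfl⟩)

/-- The tuples over `{0, 1}` of the relation named by a symbol: `R i` names the set of all
`(a₁, …, a_r)` with `a₁ + ⋯ + a_r = i` modulo `2`. -/
def parityRelation (r : ℕ) : ∀ n, ParityRel r n → Set (Fin n → ZMod 2)
  | _, .R i => {a | ∑ j, a j = i}

/-- The parity template `𝐁_r = ({0, 1}, R₀, R₁)`. -/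
def parityTemplate (r : ℕ) : FinStructure (parityVoc r) where
  Carrier := ZMod 2
  str := ofRelations (parityRelation r)
  fin := inferInstanceAs (Finite (ZMod 2))
  nonem := inferInstanceAs (Nonempty (ZMod 2))

end GenQuant

/-!
A structure over the vocabulary of the parity template is a system of linear equations over
`ZMod 2` with `r + 1` summands in each equation, and it is in the CSP if and only if the system is
solvable. Take an unsolvable system, replace each unknown `e` by two elements `(e, 0)` and `(e, 1)`,
and compare it with its homogeneous version. Every assignment `c` of values to the unknowns yields a
bijection, the shift of `(e, z)` to `(e, z + c e)`, between the two structures, which respects all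
equations that `c` satisfies. Hence Duplicator wins the `r`-bijective `k`-pebble game, which
characterizes `𝓛^k(𝒬_r)`-equivalence, if she can always present an assignment that violates a
single equation, out of sight of the pebbles.

This is possible for the Tseitin equations of a suitable `(r + 1)`-regular multigraph. Adding the
indicator of a path to an assignment moves the violation from one end of the path to the other.
The violation sits at a vertex from which `r + 1` disjoint legs lead to all gadgets on the other
side, and which no pebble has been near. After a move of `r` pebbles, one of the legs is still
free, and it is used to move the violation to a gadget without pebbles.
-/

namespace GenQuant

open FirstOrder

/-! ### Definability and pebble games -/

section Logic

variable {𝒬 𝒬' : Set Quantifier} {σ : FirstOrder.Language.{0, 0}} {k r : ℕ}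

/-- The formulas of `𝓛^k(𝒬)` as formulas of `𝓛^k(𝒬')`, for `𝒬 ⊆ 𝒬'`. -/
def Formula.inclusion (h : 𝒬 ⊆ 𝒬') : Formula 𝒬 σ k → Formula 𝒬' σ k
  | .equal i j => .equal i j
  | .rel n R v => .rel n R v
  | .neg φ => .neg (φ.inclusion h)
  | .conj ι φ => .conj ι fun i => (φ i).inclusion h
  | .ex i φ => .ex i (φ.inclusion h)
  | .quant q hq y ψ => .quant q (h hq) y fun n R => (ψ n R).inclusion h

theorem Formula.free_inclusion (h : 𝒬 ⊆ 𝒬') (φ : Formula 𝒬 σ k) :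
    (φ.inclusion h).free = φ.free := by
  induction φ with
  | equal | rel => rfl
  | neg _ ih => exact ih
  | conj ι φ ih => simp only [inclusion, free, ih]
  | ex i φ ih => simp only [inclusion, free, ih]
  | quant q hq y ψ ih => simp only [inclusion, free, ih]

theorem Formula.sat_inclusion (h : 𝒬 ⊆ 𝒬') (A : FinStructure σ) (φ : Formula 𝒬 σ k)
    (α : Fin k → A.Carrier) : (φ.inclusion h).Sat A α ↔ φ.Sat A α := by
  induction φ generalizing α with
  | equal | rel => rfl
  | neg φ ih => exact not_congr (ih α)
  | conj ι φ ih => exact forall_congr' fun i => ih i α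
  | ex i φ ih => exact exists_congr fun a => ih _
  | quant q hq y ψ ih => simp only [inclusion, Sat, ih]

theorem Definable.mono (h : 𝒬 ⊆ 𝒬') {C : Set (FinStructure σ)} (hC : Definable 𝒬 C) :
    Definable 𝒬' C := by
  obtain ⟨k, φ, hfree, hsat⟩ := hC
  exact ⟨k, φ.inclusion h, (φ.free_inclusion h).trans hfree,
    fun A => by simp only [hsat, φ.sat_inclusion h]⟩

theorem LogicLE.of_subset (h : 𝒬 ⊆ 𝒬') : LogicLE 𝒬 𝒬' :=
  fun _ _ _ => Definable.mono h

theorem maltsevQuantifiers_mono : Monotone maltsevQuantifiers :=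
  fun _ _ hrs _ hq => ⟨fun n hn => (hq.1 n hn).trans hrs, hq.2⟩

theorem Quantifier.exists_mem_quantifiersOfArity (q : Quantifier) :
    ∃ r, q ∈ quantifiersOfArity r := by
  obtain ⟨r, hr⟩ := (Set.finite_range (Sigma.fst : (Σ n, q.voc.Relations n) → ℕ)).bddAbove
  exact ⟨r, fun n ⟨R⟩ => hr ⟨⟨n, R⟩, rfl⟩⟩

theorem Quantifier.holds_relOf (q : Quantifier) (A : FinStructure q.voc) :
    q.Holds A.Carrier (fun _ R => relOf A.str R) ↔ A ∈ q.cls := by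
  have hstr : ofRelations (fun _ R => relOf A.str R) = A.str :=
    Language.Structure.ext (funext fun _ => funext fun f => isEmptyElim f) rfl
  rw [Quantifier.Holds, hstr]

theorem Quantifier.definable_cls (q : Quantifier) (hq : q ∈ 𝒬) : Definable 𝒬 q.cls := by
  obtain ⟨r, hr⟩ := q.exists_mem_quantifiersOfArity
  let y (n : ℕ) (R : q.voc.Relations n) : Fin n ↪ Fin r := Fin.castLEEmb (hr n ⟨R⟩)
  let φ : Formula 𝒬 q.voc r := .quant q hq y fun n R => .rel n R (y n R)
  have hfree : φ.free = ∅ := by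
    refine Set.eq_empty_of_forall_notMem ?_
    rintro x ⟨n, R, hmem, hnotMem⟩
    exact hnotMem hmem
  have hsat (A : FinStructure q.voc) (α : Fin r → A.Carrier) : φ.Sat A α ↔ A ∈ q.cls := by
    rw [← q.holds_relOf]
    simp only [φ, Formula.Sat, (y _ _).injective.extend_apply, relOf]
  exact ⟨r, φ, hfree, fun A => by simp only [hsat, forall_const]⟩

theorem Quantifier.holds_congr (q : Quantifier) {A B : Type} [Finite A] [Nonempty A] [Finite B]
    [Nonempty B] (e : A ≃ B) {S : ∀ n, q.voc.Relations n → Set (Fin n → A)}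
    {T : ∀ n, q.voc.Relations n → Set (Fin n → B)}
    (h : ∀ n R b, b ∈ S n R ↔ e ∘ b ∈ T n R) : q.Holds A S ↔ q.Holds B T := by
  let SA := ofRelations S
  let SB := ofRelations T
  have iso : A ≃[q.voc] B :=
    { toEquiv := e
      map_fun' := fun f => isEmptyElim f
      map_rel' := fun R b => (h _ R b).symm }
  exact ⟨fun hA => q.iso_closed _ _ hA ⟨iso⟩, fun hB => q.iso_closed _ _ hB ⟨iso.symm⟩⟩

/-- A strategy for Duplicator in Hella's `r`-bijective `k`-pebble game: `G α e` allows her to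
answer with the bijection `e` when the pebbles on `A` lie at `α` (and those on `B` at `e ∘ α`).
Spoiler then moves the pebbles in a set `T` of size at most `r` to new places `α'`, and their
partners to `e ∘ α'`. -/
structure IsBackAndForth (A B : FinStructure σ) (r : ℕ)
    (G : (Fin k → A.Carrier) → (A.Carrier ≃ B.Carrier) → Prop) : Prop where
  relMap_iff : ∀ {α e}, G α e → ∀ n (R : σ.Relations n) (v : Fin n → Fin k),
    A.str.RelMap R (α ∘ v) ↔ B.str.RelMap R (e ∘ α ∘ v)
  exists_next : ∀ {α e}, G α e → ∀ α' (T : Finset (Fin k)), T.card ≤ r →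
    (∀ x ∉ T, α' x = α x) → ∃ e', G α' e' ∧ e' ∘ α' = e ∘ α'

theorem IsBackAndForth.sat_iff {A B : FinStructure σ} (hr : 1 ≤ r)
    {G : (Fin k → A.Carrier) → (A.Carrier ≃ B.Carrier) → Prop} (hG : IsBackAndForth A B r G)
    (φ : Formula (quantifiersOfArity r) σ k) {α : Fin k → A.Carrier} {e : A.Carrier ≃ B.Carrier}
    (h : G α e) : φ.Sat A α ↔ φ.Sat B (e ∘ α) := by
  induction φ generalizing α e with
  | equal i j => exact e.injective.eq_iff.symm
  | rel n R v => exact hG.relMap_iff h n R v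
  | neg φ ih => exact not_congr (ih h)
  | conj ι φ ih => exact forall_congr' fun i => ih i h
  | ex i φ ih =>
    refine e.exists_congr fun a => ?_
    obtain ⟨e', he', heq⟩ := hG.exists_next h (Function.update α i a) {i} (by simpa using hr)
      fun x hx => Function.update_of_ne (by simpa using hx) _ _
    rw [ih he', heq, Function.comp_update]
  | quant q hq y ψ ih =>
    refine q.holds_congr e fun n R b => ?_
    obtain ⟨e', he', heq⟩ := hG.exists_next h (Function.extend (y n R) b α)
      (Finset.univ.map (y n R)) (by simpa using hq n ⟨R⟩)
      fun x hx => Function.extend_apply' _ _ _ (by simpa using hx)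
    have hextend : e ∘ Function.extend (y n R) b α = Function.extend (y n R) (e ∘ b) (e ∘ α) :=
      funext fun x => Function.apply_extend e _ _ x
    rw [Set.mem_ofPred_eq, Set.mem_ofPred_eq, ih n R he', heq, hextend]

end Logic

/-! ### Maltsev-closed CSP quantifiers -/

/-- The reason for using the partial function `maltsev`: every map into a set with a Maltsev
operation commutes with it. -/
theorem map_eq_of_mem_maltsev {A B : Type} {m : B → B → B → B}
    (hm : ∀ a b, m a a b = b ∧ m b a a = b) (f : A → B) {x : Fin 3 → A} {d : A}
    (hd : d ∈ maltsev A x) : f d = m (f (x 0)) (f (x 1)) (f (x 2)) := by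
  rw [show x = ![x 0, x 1, x 2] from List.ofFn_inj.mp rfl, mem_maltsev] at hd
  obtain ⟨h01, rfl⟩ | ⟨h12, rfl⟩ := hd
  · rw [h01, (hm _ _).1]
  · rw [h12, (hm _ _).2]

theorem pClosed_maltsev_cspQuantifier {τ : FirstOrder.Language.{0, 0}} [FinRelational τ]
    {B : FinStructure τ} (hB : HasMaltsevPolymorphism B) : PClosed maltsev (cspQuantifier B) := by
  obtain ⟨m, hm, hpol⟩ := hB
  rintro A _ _ SA SB ⟨h⟩ hle
  refine ⟨@Language.Hom.mk τ A B.Carrier SA _ h.toFun (fun f => isEmptyElim f) ?_⟩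
  intro n R x hx
  obtain hx | ⟨M, hM, hx⟩ := hle n R hx
  · exact h.map_rel' R x hx
  · have hrow (i : Fin 3) : h.toFun ∘ M i ∈ relOf B.str R := h.map_rel' R _ (hM i)
    have hcomp : h.toFun ∘ x =
        fun j => m (h.toFun (M 0 j)) (h.toFun (M 1 j)) (h.toFun (M 2 j)) :=
      funext fun j => map_eq_of_mem_maltsev hm h.toFun (hx j)
    exact hcomp ▸ hpol n R _ (hrow 0) _ (hrow 1) _ (hrow 2)

theorem hasMaltsevPolymorphism_parityTemplate (n : ℕ) :
    HasMaltsevPolymorphism (parityTemplate n) := by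
  refine ⟨fun a b c : ZMod 2 => a + b + c,
    (by decide : ∀ a b : ZMod 2, a + a + b = b ∧ b + a + a = b), ?_⟩
  rintro _ ⟨i⟩
  change ∀ x : Fin n → ZMod 2, ∑ j, x j = i → ∀ y : Fin n → ZMod 2, ∑ j, y j = i →
    ∀ z : Fin n → ZMod 2, ∑ j, z j = i → ∑ j, (x j + y j + z j) = i
  intro x hx y hy z hz
  rw [Finset.sum_add_distrib, Finset.sum_add_distrib, hx, hy, hz, CharTwo.add_self_eq_zero,
    zero_add]

theorem cspQuantifier_parityTemplate_mem_maltsevQuantifiers (n : ℕ) :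
    cspQuantifier (parityTemplate n) ∈ maltsevQuantifiers n := by
  refine ⟨?_, pClosed_maltsev_cspQuantifier (hasMaltsevPolymorphism_parityTemplate n)⟩
  rintro _ ⟨⟨i⟩⟩
  exact le_rfl

/-! ### Systems of parity equations -/

section ParitySystem

variable {V : Type*} {E : Type} {n r k : ℕ}

/-- The left-hand sides of a system of linear equations over `ZMod 2` with unknowns in `E`, in
which equation `v` has the `n` summands `inc v 0, …, inc v (n - 1)`. If `inc` lists the edges at
the vertices of an `n`-regular multigraph, these are the Tseitin equations. -/
def paritySum (inc : V → Fin n → E) : (E → ZMod 2) →+ (V → ZMod 2) where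
  toFun x v := ∑ j, x (inc v j)
  map_zero' := funext fun _ => Finset.sum_const_zero
  map_add' _ _ := funext fun _ => Finset.sum_add_distrib

theorem paritySum_apply (inc : V → Fin n → E) (x : E → ZMod 2) (v : V) :
    paritySum inc x v = ∑ j, x (inc v j) :=
  rfl

/-- The relations of `parityStructure`. -/
def paritySystemRelation (inc : V → Fin n → E) (b : V → ZMod 2) :
    ∀ m, ParityRel n m → Set (Fin m → E × ZMod 2)
  | _, .R i => {x | ∃ v, (∀ j, (x j).1 = inc v j) ∧ ∑ j, (x j).2 = i + b v}

/-- The system `paritySum inc x = b` as a structure. The element `(e, z)` stands for the value of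
the unknown `e` plus `z`, so that equation `v` constrains the sum of `(inc v 0, z₀), …` to be
`b v + z₀ + ⋯`. -/
def parityStructure [Finite E] [Nonempty E] (inc : V → Fin n → E) (b : V → ZMod 2) :
    FinStructure (parityVoc n) where
  Carrier := E × ZMod 2
  str := ofRelations (paritySystemRelation inc b)

theorem parityStructure_mem_CSP_iff [Finite E] [Nonempty E] {inc : V → Fin n → E}
    {b : V → ZMod 2} :
    parityStructure inc b ∈ CSP (parityTemplate n) ↔ ∃ x, paritySum inc x = b := by
  constructor
  · rintro ⟨h⟩
    refine ⟨fun e => h.toFun (e, (0 : ZMod 2)), funext fun v => ?_⟩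
    refine h.map_rel' (ParityRel.R (b v)) (fun j => (inc v j, (0 : ZMod 2))) ⟨v, fun _ => rfl, ?_⟩
    rw [Finset.sum_const_zero, CharTwo.add_self_eq_zero]
  · rintro ⟨x, rfl⟩
    refine ⟨⟨fun y : E × ZMod 2 => y.2 + x y.1, fun f => isEmptyElim f, ?_⟩⟩
    rintro _ ⟨i⟩ y ⟨v, hv, hy⟩
    change ∑ j, ((y j).2 + x (y j).1) = i
    simp only [Finset.sum_add_distrib, hy, hv, paritySum_apply]
    rw [add_assoc, CharTwo.add_self_eq_zero, add_zero]

/-- Addition of `c e` to the second component of every pair `(e, z)`. -/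
def shift (c : E → ZMod 2) : E × ZMod 2 ≃ E × ZMod 2 :=
  Equiv.prodShear (Equiv.refl E) fun e => Equiv.addRight (c e)

theorem comp_mem_paritySystemRelation_iff {inc : V → Fin n → E} {b : V → ZMod 2}
    {c : E → ZMod 2} {m : ℕ} (R : ParityRel n m) (x : Fin m → E × ZMod 2)
    (hc : ∀ v, Set.range (inc v) ⊆ Set.range (Prod.fst ∘ x) → paritySum inc c v = b v) :
    x ∈ paritySystemRelation inc 0 m R ↔ shift c ∘ x ∈ paritySystemRelation inc b m R := by
  obtain ⟨i⟩ := R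
  refine exists_congr fun v => and_congr_right fun hv => ?_
  have hsum : ∑ j, c (x j).1 = b v := by
    rw [← hc v (by rw [← funext hv]; rfl), paritySum_apply]
    simp only [hv]
  simp [shift, Finset.sum_add_distrib, hsum]

/-- A strategy of the player who claims that the system `paritySum inc x = b` is solvable, in the
game in which `k` unknowns are pebbled, and up to `r` pebbles are moved at once: `Safe p c` allows
her to choose the values `c` for all unknowns when the pebbles lie at `p`. Only the values at
pebbled unknowns are binding, both now and after the next move. -/
structure IsLocalSolutionStrategy (inc : V → Fin n → E) (b : V → ZMod 2) (r : ℕ)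
    (Safe : (Fin k → E) → (E → ZMod 2) → Prop) : Prop where
  exists_safe : ∀ p, ∃ c, Safe p c
  paritySum_eq : ∀ {p c}, Safe p c →
    ∀ v, Set.range (inc v) ⊆ Set.range p → paritySum inc c v = b v
  exists_next : ∀ {p c}, Safe p c → ∀ p' (T : Finset (Fin k)), T.card ≤ r →
    (∀ x ∉ T, p' x = p x) → ∃ c', Safe p' c' ∧ c' ∘ p' = c ∘ p'

variable [Finite E] [Nonempty E] {inc : V → Fin n → E} {b : V → ZMod 2}

theorem IsLocalSolutionStrategy.isBackAndForth {Safe : (Fin k → E) → (E → ZMod 2) → Prop}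
    (hS : IsLocalSolutionStrategy inc b r Safe) :
    IsBackAndForth (parityStructure inc 0) (parityStructure inc b) r
      fun (α : Fin k → E × ZMod 2) e => ∃ c, Safe (Prod.fst ∘ α) c ∧ shift c = e where
  relMap_iff := by
    rintro α _ ⟨c, hc, rfl⟩ m R v
    refine comp_mem_paritySystemRelation_iff R (α ∘ v) fun w hw => hS.paritySum_eq hc w ?_
    exact hw.trans (Set.range_comp_subset_range v (Prod.fst ∘ α))
  exists_next := by
    rintro α _ ⟨c, hc, rfl⟩ α' T hT hα'
    obtain ⟨c', hc', heq⟩ := hS.exists_next hc (Prod.fst ∘ α') T hT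
      fun x hx => congrArg Prod.fst (hα' x hx)
    exact ⟨_, ⟨c', hc', rfl⟩, funext fun x => Prod.ext rfl (congrArg (_ + ·) (congrFun heq x))⟩

theorem IsLocalSolutionStrategy.sat_parityStructure {Safe : (Fin k → E) → (E → ZMod 2) → Prop}
    (hS : IsLocalSolutionStrategy inc b r Safe) (hr : 1 ≤ r)
    {φ : Formula (quantifiersOfArity r) (parityVoc n) k}
    (hφ : ∀ α, φ.Sat (parityStructure inc 0) α) (γ : Fin k → E × ZMod 2) :
    φ.Sat (parityStructure inc b) γ := by
  obtain ⟨c, hc⟩ := hS.exists_safe (Prod.fst ∘ γ)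
  have hγ : shift c ∘ (shift c).symm ∘ γ = γ := funext fun x => (shift c).apply_symm_apply (γ x)
  have hsat := (hS.isBackAndForth.sat_iff hr φ (α := (shift c).symm ∘ γ) ⟨c, hc, rfl⟩).1 (hφ _)
  exact hγ ▸ hsat

theorem not_definable_CSP_parityTemplate_of_strategies (hr : 1 ≤ r)
    (h : ∀ k : ℕ, ∃ (V E : Type) (_ : Finite E) (_ : Nonempty E) (inc : V → Fin n → E)
      (b : V → ZMod 2) (Safe : (Fin k → E) → (E → ZMod 2) → Prop),
      IsLocalSolutionStrategy inc b r Safe ∧ ∀ x, paritySum inc x ≠ b) :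
    ¬ Definable (quantifiersOfArity r) (CSP (parityTemplate n)) := by
  rintro ⟨k, φ, -, hφ⟩
  obtain ⟨V, E, _, _, inc, b, Safe, hS, hb⟩ := h k
  have hA := (hφ (parityStructure inc 0)).1 (parityStructure_mem_CSP_iff.2 ⟨0, map_zero _⟩)
  obtain ⟨x, hx⟩ := parityStructure_mem_CSP_iff.1
    ((hφ (parityStructure inc b)).2 (hS.sat_parityStructure hr hA))
  exact hb x hx

end ParitySystem

/-! ### A multigraph in which a violated equation can hide -/

theorem sum_castSucc_add_succ {R : Type*} [Ring R] [CharP R 2] {n : ℕ} (f : Fin (n + 1) → R) :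
    ∑ t : Fin n, (f t.castSucc + f t.succ) = f 0 + f (Fin.last n) := by
  induction n with
  | zero => simp [CharTwo.add_self_eq_zero]
  | succ n ih =>
    simp only [Fin.sum_univ_castSucc, ← Fin.castSucc_succ, ih (fun t => f t.castSucc),
      Fin.castSucc_zero, Fin.succ_last]
    rw [← add_assoc, CharTwo.add_cancel_right]

section ThetaGraph

variable {d M k : ℕ}

/-- The vertices of the multigraph. Gadget `(β, i)`, for a side `β` and an index `i`, consists of a
near and a far root joined by `d + 2` disjoint legs with `M` inner nodes each. The far roots only
serve to make the multigraph regular, of degree `d + 2`. -/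
inductive ThetaVertex (d M : ℕ) : Type
  | root (β : Bool) (i : Fin M) (far : Bool)
  | node (β : Bool) (i : Fin M) (a : Fin (d + 2)) (t : Fin M)
  deriving DecidableEq, Fintype

/-- The edges of the multigraph: `leg β i a t`, for `t = 0, …, M`, are the consecutive edges of leg
`a` of gadget `(β, i)`, from the near to the far root, and `cross f a s`, for `s < d`, are parallel
edges between node `f false` on leg `a` of gadget `(true, f true)` and node `f true` on leg `a` of
gadget `(false, f false)`. -/
inductive ThetaEdge (d M : ℕ) : Type
  | leg (β : Bool) (i : Fin M) (a : Fin (d + 2)) (t : Fin (M + 1))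
  | cross (f : Bool → Fin M) (a : Fin (d + 2)) (s : Fin d)
  deriving DecidableEq, Fintype

/-- The pair consisting of index `i` on the side `β` and index `j` on the other side. -/
def sidePair (β : Bool) (i j : Fin M) : Bool → Fin M :=
  fun β' => if β' = β then i else j

theorem sidePair_not (β : Bool) (i j : Fin M) : sidePair (!β) j i = sidePair β i j := by
  funext β'
  cases β <;> cases β' <;> rfl

theorem sidePair_eq_sidePair_iff {β β' : Bool} {i i' j j' : Fin M} :
    sidePair β' i' j' = sidePair β i j ↔
      β' = β ∧ i' = i ∧ j' = j ∨ β' = !β ∧ i' = j ∧ j' = i := by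
  cases β <;> cases β' <;> simp [sidePair, funext_iff, and_comm]

namespace ThetaEdge

/-- The index of the leg on which the ends of an edge lie. -/
def legIndex : ThetaEdge d M → Fin (d + 2)
  | leg _ _ a _ => a
  | cross _ a _ => a

/-- The edge has an end in gadget `(β, i)`. -/
def Touches (β : Bool) (i : Fin M) : ThetaEdge d M → Prop
  | leg β' i' _ _ => β' = β ∧ i' = i
  | cross f _ _ => f β = i

theorem Touches.unique {β : Bool} {i j : Fin M} {e : ThetaEdge d M} (hi : e.Touches β i)
    (hj : e.Touches β j) : i = j := by
  cases e with
  | leg => exact hi.2.symm.trans hj.2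
  | cross => exact hi.symm.trans hj

theorem exists_forall_not_touches {ι : Type*} [Fintype ι] (hM : Fintype.card ι < M) (β : Bool)
    (p : ι → ThetaEdge d M) : ∃ i, ∀ x, ¬ (p x).Touches β i := by
  by_contra! h
  choose x hx using h
  have hinj : Function.Injective x := fun i j hij => (hx i).unique (hij ▸ hx j)
  exact hM.not_ge (by simpa using Fintype.card_le_of_injective x hinj)

/-- The indicator of the part of leg `a` of gadget `(β, i)` from the near root to node `j`. -/
def stem (β : Bool) (i j : Fin M) (a : Fin (d + 2)) : ThetaEdge d M → ZMod 2
  | leg β' i' a' t => if β' = β ∧ i' = i ∧ a' = a ∧ t.val ≤ j.val then 1 else 0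
  | cross _ _ _ => 0

theorem stem_eq_zero {β : Bool} {i j : Fin M} {a : Fin (d + 2)} {e : ThetaEdge d M}
    (h : e.legIndex = a → ¬ e.Touches β i) : stem β i j a e = 0 := by
  cases e with
  | leg => exact if_neg fun ⟨hβ, hi, ha, _⟩ => h ha ⟨hβ, hi⟩
  | cross => rfl

variable [NeZero d]

/-- The indicator of a path from the near root of gadget `(β, i)` to the near root of gadget
`(!β, j)` along the two legs with index `a`. -/
def path (β : Bool) (i j : Fin M) (a : Fin (d + 2)) : ThetaEdge d M → ZMod 2 :=
  stem β i j a + Pi.single (cross (sidePair β i j) a 0) 1 + stem (!β) j i a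

theorem path_eq_zero {β : Bool} {i j : Fin M} {a : Fin (d + 2)} {e : ThetaEdge d M}
    (h : e.legIndex = a → ¬ e.Touches β i ∧ ¬ e.Touches (!β) j) : path β i j a e = 0 := by
  have hcross : e ≠ cross (sidePair β i j) a 0 := by
    rintro rfl
    exact (h rfl).1 (if_pos rfl)
  simp only [path, Pi.add_apply, stem_eq_zero fun ha => (h ha).1, stem_eq_zero fun ha => (h ha).2,
    Pi.single_eq_of_ne hcross, add_zero]

end ThetaEdge

namespace ThetaVertex

open ThetaEdge

/-- The edges at a vertex. -/
def edges : ThetaVertex d M → Fin (d + 2) → ThetaEdge d M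
  | root β i false => fun a => leg β i a 0
  | root β i true => fun a => leg β i a (Fin.last M)
  | node β i a t => Fin.cons (leg β i a t.castSucc)
      (Fin.cons (leg β i a t.succ) fun s => cross (sidePair β i t) a s)

theorem paritySum_edges_node (x : ThetaEdge d M → ZMod 2) (β : Bool) (i : Fin M)
    (a : Fin (d + 2)) (t : Fin M) :
    paritySum edges x (node β i a t) = x (leg β i a t.castSucc) + x (leg β i a t.succ) +
      ∑ s, x (cross (sidePair β i t) a s) := by
  simp only [paritySum_apply, edges, Fin.sum_univ_succ (n := d + 1), Fin.sum_univ_succ (n := d),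
    Fin.cons_zero, Fin.cons_succ, add_assoc]

theorem paritySum_edges_stem (β : Bool) (i j : Fin M) (a : Fin (d + 2)) :
    paritySum edges (stem β i j a) =
      Pi.single (root β i false) 1 + Pi.single (node β i a j) 1 := by
  funext v
  obtain ⟨β', i', _ | _⟩ | ⟨β', i', a', t⟩ := v
  · simp [paritySum_apply, edges, stem, Pi.single_apply, ite_and]
  · simp [paritySum_apply, edges, stem, Nat.not_le.2]
  · rw [paritySum_edges_node]
    have := CharTwo.add_self_eq_zero (1 : ZMod 2)
    simp only [stem, Pi.single_apply, Pi.add_apply, Fin.val_castSucc, Fin.val_succ, reduceCtorEq,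
      if_false, Finset.sum_const_zero, node.injEq, Fin.ext_iff]
    grind

theorem paritySum_edges_single_cross (β : Bool) (i j : Fin M) (a : Fin (d + 2)) (s : Fin d) :
    paritySum edges (Pi.single (cross (sidePair β i j) a s) 1) =
      Pi.single (node β i a j) 1 + Pi.single (node (!β) j a i) 1 := by
  funext v
  obtain ⟨β', i', _ | _⟩ | ⟨β', i', a', t⟩ := v
  · simp [paritySum_apply, edges]
  · simp [paritySum_apply, edges]
  · rw [paritySum_edges_node]
    simp only [Pi.single_apply, Pi.add_apply, reduceCtorEq, if_false, cross.injEq, node.injEq,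
      sidePair_eq_sidePair_iff]
    simp only [ite_and, Finset.sum_ite_irrel, Finset.sum_ite_eq', Finset.mem_univ, if_true,
      Finset.sum_const_zero]
    cases β <;> grind

theorem paritySum_edges_path [NeZero d] (β : Bool) (i j : Fin M) (a : Fin (d + 2)) :
    paritySum edges (path β i j a) =
      Pi.single (root β i false) 1 + Pi.single (root (!β) j false) 1 := by
  rw [path, map_add, map_add, paritySum_edges_stem, paritySum_edges_single_cross,
    paritySum_edges_stem]
  have hcancel (y : ThetaVertex d M → ZMod 2) : y + y = 0 := ZModModule.add_self y
  calc
    _ = Pi.single (root β i false) 1 + Pi.single (root (!β) j false) 1 +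
        (Pi.single (node β i a j) 1 + Pi.single (node β i a j) 1) +
        (Pi.single (node (!β) j a i) 1 + Pi.single (node (!β) j a i) 1) := by abel
    _ = _ := by rw [hcancel, hcancel, add_zero, add_zero]

theorem sum_eq_sum_gadgets {N : Type*} [AddCommMonoid N] (f : ThetaVertex d M → N) :
    ∑ v, f v =
      ∑ β, ∑ i, (f (root β i false) + f (root β i true) + ∑ a, ∑ t, f (node β i a t)) := by
  let e : ThetaVertex d M ≃ (Bool × Fin M × Bool) ⊕ (Bool × Fin M × Fin (d + 2) × Fin M) :=
    { toFun := fun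
        | root β i far => .inl (β, i, far)
        | node β i a t => .inr (β, i, a, t)
      invFun := fun
        | .inl (β, i, far) => root β i far
        | .inr (β, i, a, t) => node β i a t
      left_inv := by rintro (_ | _) <;> rfl
      right_inv := by rintro (_ | _) <;> rfl }
  simp only [← e.symm.sum_comp, Fintype.sum_sum_type, Fintype.sum_prod_type, Fintype.sum_bool,
    Finset.sum_add_distrib, e, Equiv.coe_fn_symm_mk]
  abel

theorem sum_gadget_paritySum_edges (x : ThetaEdge d M → ZMod 2) (β : Bool) (i : Fin M) :
    paritySum edges x (root β i false) + paritySum edges x (root β i true) +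
        ∑ a, ∑ t, paritySum edges x (node β i a t) =
      ∑ t, ∑ a, ∑ s, x (cross (sidePair β i t) a s) := by
  have hleg (a : Fin (d + 2)) :
      ∑ t, paritySum edges x (node β i a t) = x (leg β i a 0) + x (leg β i a (Fin.last M)) +
        ∑ t, ∑ s, x (cross (sidePair β i t) a s) := by
    rw [← sum_castSucc_add_succ fun t => x (leg β i a t), ← Finset.sum_add_distrib]
    exact Finset.sum_congr rfl fun t _ => paritySum_edges_node x β i a t
  simp only [hleg, Finset.sum_add_distrib]
  rw [paritySum_apply, paritySum_apply]
  exact (CharTwo.add_cancel_left _ _).trans Finset.sum_comm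

theorem sum_paritySum_edges (x : ThetaEdge d M → ZMod 2) : ∑ v, paritySum edges x v = 0 := by
  rw [sum_eq_sum_gadgets]
  have hswap : ∑ i, ∑ t, ∑ a, ∑ s, x (cross (sidePair false i t) a s) =
      ∑ i, ∑ t, ∑ a, ∑ s, x (cross (sidePair true i t) a s) := by
    rw [Finset.sum_comm]
    simp only [← sidePair_not true, Bool.not_true]
  simp only [sum_gadget_paritySum_edges, Fintype.sum_bool, hswap, CharTwo.add_self_eq_zero]

end ThetaVertex

open ThetaEdge ThetaVertex

/-- The values `c` solve the system with right-hand sides `b`, except for one equation, which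
belongs to the near root of a gadget without pebbles. -/
def HasHiddenViolation (b : ThetaVertex d M → ZMod 2) (p : Fin k → ThetaEdge d M)
    (c : ThetaEdge d M → ZMod 2) : Prop :=
  ∃ β i, (∀ x, ¬ (p x).Touches β i) ∧
    paritySum edges c = b + Pi.single (root β i false) 1

theorem HasHiddenViolation.paritySum_eq {b : ThetaVertex d M → ZMod 2} {p : Fin k → ThetaEdge d M}
    {c : ThetaEdge d M → ZMod 2} (h : HasHiddenViolation b p c) {v : ThetaVertex d M}
    (hv : Set.range v.edges ⊆ Set.range p) : paritySum edges c v = b v := by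
  obtain ⟨β, i, hp, hc⟩ := h
  have hne : v ≠ root β i false := by
    rintro rfl
    obtain ⟨x, hx⟩ := hv ⟨0, rfl⟩
    exact hp x (hx ▸ ⟨rfl, rfl⟩)
  rw [hc, Pi.add_apply, Pi.single_eq_of_ne hne, add_zero]

variable [NeZero d]

theorem exists_hasHiddenViolation_single (hM : k < M) (β : Bool) (i : Fin M)
    (p : Fin k → ThetaEdge d M) :
    ∃ c, HasHiddenViolation (Pi.single (root β i false) 1) p c := by
  obtain ⟨j, hj⟩ := exists_forall_not_touches (by simpa using hM) (!β) p
  exact ⟨path β i j 0, !β, j, hj, paritySum_edges_path β i j 0⟩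

/-- At most `d + 1` pebbles move, so the pebbles leave one of the `d + 2` legs of the gadget of the
violated equation free, and through this leg the violation escapes to a gadget on the other side. -/
theorem HasHiddenViolation.exists_next {b : ThetaVertex d M → ZMod 2} {p p' : Fin k → ThetaEdge d M}
    {c : ThetaEdge d M → ZMod 2} (h : HasHiddenViolation b p c) (hM : k < M) {T : Finset (Fin k)}
    (hT : T.card ≤ d + 1) (hpp' : ∀ x ∉ T, p' x = p x) :
    ∃ c', HasHiddenViolation b p' c' ∧ c' ∘ p' = c ∘ p' := by
  obtain ⟨β, i, hp, hc⟩ := h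
  have hcard : (T.image fun x => (p' x).legIndex).card < Fintype.card (Fin (d + 2)) := by
    rw [Fintype.card_fin]
    exact Finset.card_image_le.trans_lt (Nat.lt_succ_of_le hT)
  obtain ⟨a, -, ha⟩ := Finset.exists_mem_notMem_of_card_lt_card hcard
  obtain ⟨j, hj⟩ := exists_forall_not_touches (by simpa using hM) (!β) p'
  have hpath (x : Fin k) : path β i j a (p' x) = 0 := by
    refine path_eq_zero fun hx => ⟨?_, hj x⟩
    rw [hpp' x fun hxT => ha (Finset.mem_image.2 ⟨x, hxT, hx⟩)]
    exact hp x
  refine ⟨c + path β i j a, ⟨!β, j, hj, ?_⟩, funext fun x => ?_⟩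
  · rw [map_add, hc, paritySum_edges_path, add_assoc, ← add_assoc (Pi.single (root β i false) 1),
      ZModModule.add_self, zero_add]
  · simp only [Function.comp_apply, Pi.add_apply, hpath, add_zero]

theorem isLocalSolutionStrategy_hasHiddenViolation (hM : k < M) (β : Bool) (i : Fin M) :
    IsLocalSolutionStrategy (edges (d := d)) (Pi.single (root β i false) 1) (d + 1)
      (HasHiddenViolation (k := k) (Pi.single (root β i false) 1)) where
  exists_safe := exists_hasHiddenViolation_single hM β i
  paritySum_eq h _ := h.paritySum_eq
  exists_next h _ _ := h.exists_next hM

theorem not_definable_CSP_parityTemplate {r : ℕ} (hr : 2 ≤ r) :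
    ¬ Definable (quantifiersOfArity r) (CSP (parityTemplate (r + 1))) := by
  obtain ⟨d, rfl⟩ := Nat.exists_eq_add_of_le' (Nat.one_le_of_lt hr)
  have : NeZero d := ⟨by lia⟩
  refine not_definable_CSP_parityTemplate_of_strategies (Nat.le_add_left 1 d) fun k =>
    ⟨ThetaVertex d (k + 1), ThetaEdge d (k + 1), inferInstance, ⟨leg true 0 0 0⟩, edges, _, _,
      isLocalSolutionStrategy_hasHiddenViolation k.lt_succ_self true 0, fun x hx => ?_⟩
  simpa [hx] using sum_paritySum_edges x

end ThetaGraph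

end GenQuant

theorem mainTheorem5_general (r : ℕ) (hr : 2 ≤ r) :
    GenQuant.LogicLT (GenQuant.maltsevQuantifiers r) (GenQuant.maltsevQuantifiers (r + 1)) ∧
    GenQuant.HasMaltsevPolymorphism (GenQuant.parityTemplate (r + 1)) ∧
    GenQuant.cspQuantifier (GenQuant.parityTemplate (r + 1)) ∈
      GenQuant.maltsevQuantifiers (r + 1) ∧
    GenQuant.Definable (GenQuant.maltsevQuantifiers (r + 1))
      (GenQuant.CSP (GenQuant.parityTemplate (r + 1))) ∧
    ¬ GenQuant.Definable (GenQuant.quantifiersOfArity r)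
      (GenQuant.CSP (GenQuant.parityTemplate (r + 1))) := by
  have hmem := GenQuant.cspQuantifier_parityTemplate_mem_maltsevQuantifiers (r + 1)
  have hdef := GenQuant.Quantifier.definable_cls _ hmem
  have hnot := GenQuant.not_definable_CSP_parityTemplate hr
  have hle := GenQuant.LogicLE.of_subset (GenQuant.maltsevQuantifiers_mono r.le_succ)
  have hnle : ¬ GenQuant.LogicLE (GenQuant.maltsevQuantifiers (r + 1))
      (GenQuant.maltsevQuantifiers r) :=
    fun h => hnot ((h _ _ hdef).mono fun _ hq => hq.1)
  exact ⟨⟨hle, hnle⟩, GenQuant.hasMaltsevPolymorphism_parityTemplate (r + 1), hmem, hdef, hnot⟩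

theorem mainTheorem5 (r : ℕ) (hr : 3 ≤ r) :
    GenQuant.LogicLT (GenQuant.maltsevQuantifiers r) (GenQuant.maltsevQuantifiers (r + 1)) ∧
    GenQuant.HasMaltsevPolymorphism (GenQuant.parityTemplate (r + 1)) ∧
    GenQuant.cspQuantifier (GenQuant.parityTemplate (r + 1)) ∈
      GenQuant.maltsevQuantifiers (r + 1) ∧
    GenQuant.Definable (GenQuant.maltsevQuantifiers (r + 1))
      (GenQuant.CSP (GenQuant.parityTemplate (r + 1))) ∧
    ¬ GenQuant.Definable (GenQuant.quantifiersOfArity r)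
      (GenQuant.CSP (GenQuant.parityTemplate (r + 1))) :=
  mainTheorem5_general r (by lia)
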